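/- \textbf{Setting.} Fix an integer $k\ge 1$ (the number of pivots) and put $m=\lceil\frac{k+1}{2}\rceil$. The input is a uniformly random permutation $(e_1,\dots,e_n)$ of $\{1,\dots,n\}$, stored in an array $A[1..n]$, with $n>k$. The elements $e_1,\dots,e_k$ are the pivots; let $p_1<\dots<p_k$ be the pivots in sorted order, $p_0=0$, $p_{k+1}=n+1$. A non-pivot element $x$ belongs to group $\mathrm A_h$, $0\le h\le k$, if $p_h<x<p_{h+1}$. Group memberships are known for free. The operation $\mathtt{rotate}(i_1,\dots,i_\ell)$ performs $tmp\gets A[i_1];\ A[i_1]\gets A[i_2];\ \dots;\ A[i_{\ell-1}]\gets A[i_\ell];\ A[i_\ell]\gets tmp$; it makes $\ell$ write accesses (to array cells) and $\ell+1$ assignments. \textbf{Algorithm $\mathit{Exchange}_k$.} Set $\mathtt i\gets k+1$, $\mathtt j\gets n$, $\mathtt b_1,\dots,\mathtt b_{m-1}\gets k+1$ and $\mathtt b_m,\dots,\mathtt b_{k-1}\gets n$. While $\mathtt i<\mathtt j$, do the following: (1) while $A[\mathtt i]$ belongs to a group $\mathrm A_p$ with $p<m$: if $p<m-1$, perform $\mathtt{rotate}(\mathtt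 i,\mathtt b_{m-1},\dots,\mathtt b_{p+1})$ and then increment $\mathtt b_{p+1},\dots,\mathtt b_{m-1}$; in any case increment $\mathtt i$; (2) while $A[\mathtt j]$ belongs to a group $\mathrm A_q$ with $q\ge m$: if $q\ge m+1$, perform $\mathtt{rotate}(\mathtt j,\mathtt b_m,\dots,\mathtt b_{q-1})$ and then decrement $\mathtt b_m,\dots,\mathtt b_{q-1}$; in any case decrement $\mathtt j$; (3) if $\mathtt i<\mathtt j$, with $A[\mathtt i]$ in $\mathrm A_p$ and $A[\mathtt j]$ in $\mathrm A_q$: perform $\mathtt{rotate}(\mathtt i,\mathtt b_{m-1},\dots,\mathtt b_{q+1},\mathtt j,\mathtt b_m,\dots,\mathtt b_{p-1})$, then increment $\mathtt i,\mathtt b_{q+1},\dots,\mathtt b_{m-1}$ and decrement $\mathtt j,\mathtt b_m,\dots,\mathtt b_{p-1}$. (Pivot cells and positions outside the array belong to no group, so the inner loops end there.) \textbf{Cost measures.} A pointer with initial value $l_s$ and final value $l_e$ has cost $|l_s-l_e|$. The number $\mathrm P^{\mathrm{se}}_n$ of scanned elements is the sum of the costs of the pointers $\mathtt i,\mathtt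 j,\mathtt b_1,\dots,\mathtt b_{k-1}$; $\mathrm P^{\mathrm{wa}}_n$ and $\mathrm P^{\mathrm{as}}_n$ are the total numbers of write accesses and of assignments over all rotate operations performed by $\mathit{Exchange}_k$. \textbf{Theorem.} For every fixed $k\ge1$, as $n\to\infty$ (with the constants in $O(1)$ depending only on $k$), $$\mathrm E(\mathrm P^{\mathrm{se}}_n)=\begin{cases}\dfrac{m+1}{2}\,n+O(1),&k\text{ odd},\\[1.5ex]\dfrac{m^2}{2m-1}\,n+O(1),&k\text{ even},\end{cases}$$ $$\mathrm E(\mathrm P^{\mathrm{wa}}_n)=\begin{cases}\dfrac{2m^3+3m^2-m-2}{2m(2m+1)}\,n+O(1),&k\text{ odd},\\[1.5ex]\dfrac{2m^3-2m-1}{2m(2m-1)}\,n+O(1),&k\text{ even},\end{cases}$$ $$\mathrm E(\mathrm P^{\mathrm{as}}_n)=\begin{cases}\dfrac{2m^3+6m^2-m-4}{2m(2m+1)}\,n+O(1),&k\text{ odd},\\[1.5ex]\dfrac{2m^3+3m^2-5m-2}{2m(2m-1)}\,n+O(1),&k\text{ even}.\end{cases}$$ -/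

import Mathlib

namespace MultiPivot

/-- The arrays are indexed from `1` as in `A[1..n]`; the entry of a cell is the index `h` of the
group `A_h` to which the element in that cell belongs.
Loop of the operation `rotate`: for the remaining index list `x :: y :: l` perform `A[x] ← A[y]` and
go on with `y :: l`; for the last index `x` perform `A[x] ← tmp`. -/
def rotateAux (tmp : ℕ) : (ℕ → ℕ) → List ℕ → (ℕ → ℕ)
  | A, [] => A
  | A, [x] => Function.update A x tmp
  | A, x :: y :: l => rotateAux tmp (Function.update A x (A y)) (y :: l)

/-- `rotate(i₁,…,i_ℓ)`: `tmp ← A[i₁]; A[i₁] ← A[i₂]; …; A[i_{ℓ-1}] ← A[i_ℓ]; A[i_ℓ] ← tmp`. -/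
def rotate (A : ℕ → ℕ) : List ℕ → (ℕ → ℕ)
  | [] => A
  | x :: l => rotateAux (A x) A (x :: l)

/-- The memory of the algorithm: the array, the pointers `i` and `j`, the border pointers
`b 1, …, b (k - 1)`, and two counters for the costs of all `rotate` operations made so far. -/
structure State where
  A : ℕ → ℕ
  i : ℕ
  j : ℕ
  b : ℕ → ℕ
  writes : ℕ
  assigns : ℕ

namespace State

/-- Perform `rotate(l)`. With `ℓ` indices it makes `ℓ` write accesses and `ℓ + 1` assignments. -/
def rot (s : State) (l : List ℕ) : State :=
  { s with
    A := rotate s.A l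
    writes := s.writes + l.length
    assigns := s.assigns + (l.length + 1) }

/-- The list `b_{m-1}, …, b_{p+1}` of border pointer values (empty if `p ≥ m - 1`). -/
def leftBorders (s : State) (m p : ℕ) : List ℕ := ((List.Ico (p + 1) m).reverse).map s.b

/-- The list `b_m, …, b_{q-1}` of border pointer values (empty if `q ≤ m`). -/
def rightBorders (s : State) (m q : ℕ) : List ℕ := (List.Ico m q).map s.b

/-- `b_{p+1}++; …; b_{m-1}++`. -/
def incBorders (s : State) (m p : ℕ) : State :=
  { s with b := fun t => if p + 1 ≤ t ∧ t < m then s.b t + 1 else s.b t }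

/-- `b_m--; …; b_{q-1}--`. -/
def decBorders (s : State) (m q : ℕ) : State :=
  { s with b := fun t => if m ≤ t ∧ t < q then s.b t - 1 else s.b t }

/-- `i++`. -/
def incI (s : State) : State := { s with i := s.i + 1 }

/-- `j--`. -/
def decJ (s : State) : State := { s with j := s.j - 1 }

end State

/-- The body of the first inner loop, executed when `A[i]` belongs to group `A_p`, `p < m`. -/
def bodyI (m : ℕ) (s : State) : State :=
  let p := s.A s.i
  (if p + 1 < m then (s.rot (s.i :: s.leftBorders m p)).incBorders m p else s).incI

/-- The body of the second inner loop, executed when `A[j]` belongs to group `A_q`, `q ≥ m`. -/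
def bodyJ (m : ℕ) (s : State) : State :=
  let q := s.A s.j
  (if m + 1 ≤ q then (s.rot (s.j :: s.rightBorders m q)).decBorders m q else s).decJ

/-- The exchange step: with `A[i]` in group `A_p` and `A[j]` in group `A_q`,
`rotate(i, b_{m-1}, …, b_{q+1}, j, b_m, …, b_{p-1})`, followed by the pointer updates. -/
def exchangeStep (m : ℕ) (s : State) : State :=
  let p := s.A s.i
  let q := s.A s.j
  (((s.rot (s.i :: s.leftBorders m q ++ s.j :: s.rightBorders m p)).incI.incBorders m q).decJ).decBorders
    m p

theorem bodyI_i (m : ℕ) (s : State) : (bodyI m s).i = s.i + 1 := by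
  simp only [bodyI, State.incI]; split <;> rfl

theorem bodyI_j (m : ℕ) (s : State) : (bodyI m s).j = s.j := by
  simp only [bodyI, State.incI]; split <;> rfl

theorem bodyJ_i (m : ℕ) (s : State) : (bodyJ m s).i = s.i := by
  simp only [bodyJ, State.decJ]; split <;> rfl

theorem bodyJ_j (m : ℕ) (s : State) : (bodyJ m s).j = s.j - 1 := by
  simp only [bodyJ, State.decJ]; split <;> rfl

/-- First inner loop: while `A[i]` belongs to a group `A_p` with `p < m`.
The loop also ends when `i` leaves the array, since there is no element in `A[n+1]`. -/
def loopI (m n : ℕ) (s : State) : State :=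
  if s.i ≤ n ∧ s.A s.i < m then loopI m n (bodyI m s) else s
termination_by n + 1 - s.i
decreasing_by rw [bodyI_i]; omega

/-- Second inner loop: while `A[j]` belongs to a group `A_q` with `q ≥ m`.
The loop also ends when `j` reaches the cell `A[k]`, since that cell holds a pivot, which does not
belong to any group. -/
def loopJ (k m : ℕ) (s : State) : State :=
  if k < s.j ∧ m ≤ s.A s.j then loopJ k m (bodyJ m s) else s
termination_by s.j
decreasing_by rw [bodyJ_j]; omega

theorem loopI_pointers (m n : ℕ) (s : State) :
    s.i ≤ (loopI m n s).i ∧ (loopI m n s).j = s.j := by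
  induction s using loopI.induct m n with
  | case1 s h ih =>
    rw [loopI, if_pos h]
    rw [bodyI_i, bodyI_j] at ih
    exact ⟨by omega, ih.2⟩
  | case2 s h => rw [loopI, if_neg h]; exact ⟨le_rfl, rfl⟩

theorem loopJ_pointers (k m : ℕ) (s : State) :
    (loopJ k m s).i = s.i ∧ (loopJ k m s).j ≤ s.j := by
  induction s using loopJ.induct k m with
  | case1 s h ih =>
    rw [loopJ, if_pos h]
    rw [bodyJ_i, bodyJ_j] at ih
    exact ⟨ih.1, by omega⟩
  | case2 s h => rw [loopJ, if_neg h]; exact ⟨rfl, le_rfl⟩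

/-- The body of the outer loop: the two inner loops, and an exchange step if then `i < j`. -/
def outerBody (k m n : ℕ) (s : State) : State :=
  let s' := loopJ k m (loopI m n s)
  if s'.i < s'.j then exchangeStep m s' else s'

theorem outerBody_lt (k m n : ℕ) (s : State) (h : s.i < s.j) :
    (outerBody k m n s).j - (outerBody k m n s).i < s.j - s.i := by
  have h1 := loopI_pointers m n s
  have h2 := loopJ_pointers k m (loopI m n s)
  simp only [outerBody]
  split
  · change (loopJ k m (loopI m n s)).j - 1 - ((loopJ k m (loopI m n s)).i + 1) < s.j - s.i
    omega
  · omega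

/-- The outer loop: while `i < j`. -/
def outerLoop (k m n : ℕ) (s : State) : State :=
  if s.i < s.j then outerLoop k m n (outerBody k m n s) else s
termination_by s.j - s.i
decreasing_by rename_i h; exact outerBody_lt k m n s h

/-- `m = ⌈(k + 1) / 2⌉`, the number of groups that are gathered at the left of pointer `i`. -/
def numLeft (k : ℕ) : ℕ := (k + 1) ⌈/⌉ 2

/-- The initialization: `i, b_1, …, b_{m-1}` are set to `k + 1` and `j, b_m, …, b_{k-1}` to `n`. -/
def initState (k n : ℕ) (A : ℕ → ℕ) : State where
  A := A
  i := k + 1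
  j := n
  b := fun t => if t < numLeft k then k + 1 else n
  writes := 0
  assigns := 0

/-- The final state of `Exchange_k` on the array `A[1..n]`, whose first `k` cells hold the pivots. -/
def exchange (k n : ℕ) (A : ℕ → ℕ) : State :=
  outerLoop k (numLeft k) n (initState k n A)

/-- The input array for the permutation `(e_1, …, e_n)` given by `e_s = σ (s - 1)`. The pivots
are `e_1, …, e_k`; in sorted order `p_1 < ⋯ < p_k`, the element `x` belongs to group `A_h` if
`p_h < x < p_{h+1}`, i.e. if exactly `h` of the pivots are smaller than `x`. Only the entries of the
cells `k + 1, …, n` are relevant. -/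
def inputArray (k n : ℕ) (σ : Equiv.Perm (Fin n)) (s : ℕ) : ℕ :=
  if h : s - 1 < n then
    (Finset.univ.filter fun r : Fin n => r.val < k ∧ σ r < σ ⟨s - 1, h⟩).card
  else 0

/-- The number of cells inspected by a pointer with initial value `ls` and final value `le`. -/
def pointerCost (ls le : ℕ) : ℕ := ((ls : ℤ) - (le : ℤ)).natAbs

/-- The number of scanned elements: total cost of the pointers `i, j, b_1, …, b_{k-1}`. -/
def scanned (k n : ℕ) (σ : Equiv.Perm (Fin n)) : ℕ :=
  let s₀ := initState k n (inputArray k n σ)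
  let s₁ := exchange k n (inputArray k n σ)
  pointerCost s₀.i s₁.i + pointerCost s₀.j s₁.j +
    ∑ t ∈ Finset.Icc 1 (k - 1), pointerCost (s₀.b t) (s₁.b t)

/-- The number of write accesses to array cells over all `rotate` operations. -/
def writeAccesses (k n : ℕ) (σ : Equiv.Perm (Fin n)) : ℕ :=
  (exchange k n (inputArray k n σ)).writes

/-- The number of assignments over all `rotate` operations. -/
def assignments (k n : ℕ) (σ : Equiv.Perm (Fin n)) : ℕ :=
  (exchange k n (inputArray k n σ)).assigns

/-- The expected value of a cost for a uniformly random permutation of `n` elements. -/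
noncomputable def expectedCost (n : ℕ) (X : Equiv.Perm (Fin n) → ℕ) : ℝ :=
  (∑ σ : Equiv.Perm (Fin n), (X σ : ℝ)) / (n.factorial : ℝ)

end MultiPivot

/-!
Each cost is a sum over the elements, in which an element of group `g` is charged an amount that
depends only on `g` and on which of the pointers `i` and `j` reads it. If `L` elements belong to
groups below `m`, these pointers meet, up to one cell, after cell `k + L`, so the total cost differs
by at most a constant from a sum over the cells in which pointer `i` reads the cells up to `k + L`.

The cells after the pivots are exchangeable even when `L` is given. Hence the group of the element
at a cell may be replaced by the group of the element at one fixed cell, and then the sum over the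
cells `c ≤ k + L` by a sum over the cells `c` whose element belongs to a group below `m`. What
remains is the joint law of the groups `g` and `h` of two elements. There are `k + 1` gaps between
the pivots for the first one and then `k + 2` for the second one, two of which belong to the group
of the first, so the probability of `(g, h)` is `(1 + [g = h]) / ((k + 1) (k + 2))`.
-/

namespace MultiPivot

section Rotate

theorem rotateAux_of_notMem (tmp c : ℕ) :
    ∀ (l : List ℕ) (A : ℕ → ℕ), c ∉ l → rotateAux tmp A l c = A c
  | [], A, _ => rfl
  | [x], A, h => Function.update_of_ne (List.mem_singleton.not.mp h) _ _
  | x :: y :: l, A, h => by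
    rw [List.mem_cons, not_or] at h
    rw [rotateAux, rotateAux_of_notMem tmp c (y :: l) _ h.2, Function.update_of_ne h.1]

/- While the rotation runs, its current cell is a hole that wanders through `S`: its value has
already been copied. So nothing is assumed about `A x`, and the list may have repetitions. -/
theorem rotateAux_mem {P : ℕ → Prop} {S : Set ℕ} {tmp : ℕ} (htmp : P tmp) :
    ∀ (l : List ℕ) (x : ℕ) (A : ℕ → ℕ), (∀ c ∈ S, c ≠ x → P (A c)) → (∀ y ∈ x :: l, y ∈ S) →
      ∀ c ∈ S, P (rotateAux tmp A (x :: l) c)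
  | [], x, A, hA, _, c, hc => by
    obtain rfl | hcx := eq_or_ne c x
    · simpa only [rotateAux, Function.update_self] using htmp
    · simpa only [rotateAux, Function.update_of_ne hcx] using hA c hc hcx
  | y :: l, x, A, hA, hl, c, hc => by
    refine rotateAux_mem htmp l y _ (fun d hd hdy => ?_)
      (fun z hz => hl z (List.mem_cons_of_mem _ hz)) c hc
    obtain rfl | hdx := eq_or_ne d x
    · simpa only [Function.update_self] using hA y (hl y (by simp)) hdy.symm
    · simpa only [Function.update_of_ne hdx] using hA d hd hdx

theorem rotateAux_append (tmp z : ℕ) (l' : List ℕ) :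
    ∀ (l : List ℕ) (x : ℕ) (A : ℕ → ℕ), z ∉ x :: l →
      rotateAux tmp A (x :: l ++ z :: l') = rotateAux tmp (rotateAux (A z) A (x :: l)) (z :: l')
  | [], x, A, _ => rfl
  | y :: l, x, A, h => by
    rw [List.mem_cons, not_or] at h
    have ih := rotateAux_append tmp z l' l y (Function.update A x (A y)) h.2
    rwa [Function.update_of_ne h.1] at ih

end Rotate

section Steps

variable {m : ℕ} {s : State}

theorem bodyI_A : (bodyI m s).A =
    if s.A s.i + 1 < m then rotate s.A (s.i :: s.leftBorders m (s.A s.i)) else s.A := by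
  simp only [bodyI]; split <;> rfl

theorem bodyI_b (t : ℕ) : (bodyI m s).b t = if s.A s.i < t ∧ t < m then s.b t + 1 else s.b t := by
  simp only [bodyI]
  split
  · rfl
  · rw [if_neg (by omega)]; rfl

theorem bodyI_writes :
    (bodyI m s).writes = s.writes + if s.A s.i + 1 < m then m - s.A s.i else 0 := by
  simp only [bodyI]
  split
  · simp only [State.incI, State.incBorders, State.rot, State.leftBorders, List.length_cons,
      List.length_map, List.length_reverse, List.Ico.length]
    omega
  · rfl

theorem bodyI_assigns :
    (bodyI m s).assigns = s.assigns + if s.A s.i + 1 < m then m - s.A s.i + 1 else 0 := by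
  simp only [bodyI]
  split
  · simp only [State.incI, State.incBorders, State.rot, State.leftBorders, List.length_cons,
      List.length_map, List.length_reverse, List.Ico.length]
    omega
  · rfl

theorem bodyJ_A : (bodyJ m s).A =
    if m + 1 ≤ s.A s.j then rotate s.A (s.j :: s.rightBorders m (s.A s.j)) else s.A := by
  simp only [bodyJ]; split <;> rfl

theorem bodyJ_b (t : ℕ) : (bodyJ m s).b t = if m ≤ t ∧ t < s.A s.j then s.b t - 1 else s.b t := by
  simp only [bodyJ]
  split
  · rfl
  · rw [if_neg (by omega)]; rfl

theorem bodyJ_writes :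
    (bodyJ m s).writes = s.writes + if m + 1 ≤ s.A s.j then s.A s.j - m + 1 else 0 := by
  simp only [bodyJ]
  split
  · simp only [State.decJ, State.decBorders, State.rot, State.rightBorders, List.length_cons,
      List.length_map, List.Ico.length]
  · rfl

theorem bodyJ_assigns :
    (bodyJ m s).assigns = s.assigns + if m + 1 ≤ s.A s.j then s.A s.j - m + 2 else 0 := by
  simp only [bodyJ]
  split
  · simp only [State.decJ, State.decBorders, State.rot, State.rightBorders, List.length_cons,
      List.length_map, List.Ico.length]
  · rfl

theorem exchangeStep_b (t : ℕ) : (exchangeStep m s).b t =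
    if s.A s.j < t ∧ t < m then s.b t + 1
    else if m ≤ t ∧ t < s.A s.i then s.b t - 1 else s.b t := by
  simp only [exchangeStep, State.decBorders, State.decJ, State.incBorders, State.incI, State.rot]
  split_ifs <;> first | rfl | omega

theorem exchangeStep_writes (hi : m ≤ s.A s.i) (hj : s.A s.j < m) :
    (exchangeStep m s).writes = s.writes + (s.A s.i - m + 1) + (m - s.A s.j) := by
  simp only [exchangeStep, State.decBorders, State.decJ, State.incBorders, State.incI, State.rot,
    State.leftBorders, State.rightBorders, List.length_cons, List.length_append, List.length_map,
    List.length_reverse, List.Ico.length]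
  omega

theorem exchangeStep_assigns (hi : m ≤ s.A s.i) (hj : s.A s.j < m) :
    (exchangeStep m s).assigns = s.assigns + (s.A s.i - m + 1) + (m - s.A s.j + 1) := by
  simp only [exchangeStep, State.decBorders, State.decJ, State.incBorders, State.incI, State.rot,
    State.leftBorders, State.rightBorders, List.length_cons, List.length_append, List.length_map,
    List.length_reverse, List.Ico.length]
  omega

end Steps

/-- The geometry of the array during `Exchange_k`: the cells `k + 1, …, i - 1` hold elements of the
groups `A_0, …, A_{m-1}`, the cells `j + 1, …, n` hold elements of the groups `A_m, …, A_k`, the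
border pointers lie in the corresponding part, and the cells `i, …, j` still have their entries
from the input array `A₀`. -/
structure Partitioned (k m n : ℕ) (A₀ : ℕ → ℕ) (s : State) : Prop where
  le_i : k + 1 ≤ s.i
  j_le : s.j ≤ n
  i_le : s.i ≤ s.j + 1
  left : ∀ c, k + 1 ≤ c → c < s.i → s.A c < m
  right : ∀ c, s.j < c → c ≤ n → m ≤ s.A c
  unread : ∀ c, s.i ≤ c → c ≤ s.j → s.A c = A₀ c
  border_left : ∀ t < m, s.b t ∈ Set.Icc (k + 1) s.i
  border_right : ∀ t, m ≤ t → s.b t ∈ Set.Icc s.j n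

namespace Partitioned

variable {k m n p : ℕ} {A₀ : ℕ → ℕ} {s : State}

theorem initState (h : k + 1 ≤ n) :
    Partitioned k (numLeft k) n A₀ (initState k n A₀) where
  le_i := le_rfl
  j_le := le_rfl
  i_le := h.trans n.le_succ
  left _ hc hc' := absurd hc' hc.not_gt
  right _ hc hc' := absurd hc hc'.not_gt
  unread _ _ _ := rfl
  border_left t ht := by
    simp only [MultiPivot.initState, if_pos ht, Set.mem_Icc, le_refl, and_self]
  border_right t ht := by
    simp only [MultiPivot.initState, if_neg ht.not_gt, Set.mem_Icc, le_refl, and_self]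

theorem leftBorders_subset (hs : Partitioned k m n A₀ s) :
    ∀ y ∈ s.i :: s.leftBorders m p, y ∈ Set.Icc (k + 1) s.i := by
  simp only [List.mem_cons, State.leftBorders, List.mem_map, List.mem_reverse, List.Ico.mem]
  rintro y (rfl | ⟨t, ht, rfl⟩)
  · exact ⟨hs.le_i, le_rfl⟩
  · exact hs.border_left t ht.2

theorem rightBorders_subset (hs : Partitioned k m n A₀ s) :
    ∀ y ∈ s.j :: s.rightBorders m p, y ∈ Set.Icc s.j n := by
  simp only [List.mem_cons, State.rightBorders, List.mem_map, List.Ico.mem]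
  rintro y (rfl | ⟨t, ht, rfl⟩)
  · exact ⟨le_rfl, hs.j_le⟩
  · exact hs.border_right t ht.1

theorem rotateAux_left (hs : Partitioned k m n A₀ s) {tmp : ℕ} (htmp : tmp < m) :
    ∀ c ∈ Set.Icc (k + 1) s.i, rotateAux tmp s.A (s.i :: s.leftBorders m p) c < m :=
  rotateAux_mem (P := (· < m)) htmp _ _ _
    (fun c hc hci => hs.left c hc.1 (lt_of_le_of_ne hc.2 hci)) hs.leftBorders_subset

theorem rotateAux_left_of_gt (hs : Partitioned k m n A₀ s) {tmp c : ℕ} (hc : s.i < c) :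
    rotateAux tmp s.A (s.i :: s.leftBorders m p) c = s.A c :=
  rotateAux_of_notMem _ _ _ _ fun h => hc.not_ge (hs.leftBorders_subset c h).2

theorem rotateAux_right (hs : Partitioned k m n A₀ s) {tmp : ℕ} (htmp : m ≤ tmp) {A : ℕ → ℕ}
    (hA : ∀ c, s.j < c → c ≤ n → m ≤ A c) :
    ∀ c ∈ Set.Icc s.j n, m ≤ rotateAux tmp A (s.j :: s.rightBorders m p) c :=
  rotateAux_mem (P := (m ≤ ·)) htmp _ _ _
    (fun c hc hcj => hA c (lt_of_le_of_ne' hc.1 hcj) hc.2) hs.rightBorders_subset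

theorem rotateAux_right_of_lt (hs : Partitioned k m n A₀ s) {tmp c : ℕ} {A : ℕ → ℕ}
    (hc : c < s.j) : rotateAux tmp A (s.j :: s.rightBorders m p) c = A c :=
  rotateAux_of_notMem _ _ _ _ fun h => hc.not_ge (hs.rightBorders_subset c h).1

theorem bodyI (hs : Partitioned k m n A₀ s) (hij : s.i ≤ s.j) (hi : s.A s.i < m) :
    Partitioned k m n A₀ (bodyI m s) := by
  have hleft : ∀ c ∈ Set.Icc (k + 1) s.i, (MultiPivot.bodyI m s).A c < m := by
    rw [bodyI_A]
    split
    · exact hs.rotateAux_left hi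
    · rintro c ⟨hc, hci⟩
      obtain rfl | hci := eq_or_lt_of_le hci
      exacts [hi, hs.left c hc hci]
  have hunchanged : ∀ c, s.i < c → (MultiPivot.bodyI m s).A c = s.A c := by
    rw [bodyI_A]
    split
    · exact fun c => hs.rotateAux_left_of_gt
    · exact fun _ _ => rfl
  constructor <;> simp only [bodyI_i, bodyI_j, bodyI_b]
  · exact hs.le_i.trans s.i.le_succ
  · exact hs.j_le
  · omega
  · exact fun c hc hci => hleft c ⟨hc, Nat.le_of_lt_succ hci⟩
  · exact fun c hjc hc => by rw [hunchanged c (by omega)]; exact hs.right c hjc hc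
  · exact fun c hic hcj => by rw [hunchanged c hic]; exact hs.unread c (by omega) hcj
  · intro t ht
    have := hs.border_left t ht
    simp only [Set.mem_Icc] at *
    split <;> omega
  · intro t ht
    rw [if_neg (by omega)]
    exact hs.border_right t ht

theorem bodyJ (hs : Partitioned k m n A₀ s) (hij : s.i ≤ s.j) (hj : m ≤ s.A s.j) :
    Partitioned k m n A₀ (bodyJ m s) := by
  have hright : ∀ c ∈ Set.Icc s.j n, m ≤ (MultiPivot.bodyJ m s).A c := by
    rw [bodyJ_A]
    split
    · exact hs.rotateAux_right hj hs.right
    · rintro c ⟨hjc, hc⟩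
      obtain rfl | hjc := eq_or_lt_of_le hjc
      exacts [hj, hs.right c hjc hc]
  have hunchanged : ∀ c, c < s.j → (MultiPivot.bodyJ m s).A c = s.A c := by
    rw [bodyJ_A]
    split
    · exact fun c => hs.rotateAux_right_of_lt
    · exact fun _ _ => rfl
  have hle := hs.le_i
  constructor <;> simp only [bodyJ_i, bodyJ_j, bodyJ_b]
  · exact hle
  · exact (Nat.sub_le _ _).trans hs.j_le
  · omega
  · exact fun c hc hci => by rw [hunchanged c (by omega)]; exact hs.left c hc hci
  · exact fun c hjc hc => hright c ⟨by omega, hc⟩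
  · exact fun c hic hcj => by rw [hunchanged c (by omega)]; exact hs.unread c hic (by omega)
  · intro t ht
    rw [if_neg (by omega)]
    exact hs.border_left t ht
  · intro t ht
    have := hs.border_right t ht
    simp only [Set.mem_Icc] at *
    split <;> omega

/- Split at the index `j`, the rotation is one rotation of the left part that brings in `A[j]`,
followed by one of the right part that brings in `A[i]`. -/
theorem exchangeStep_A (hs : Partitioned k m n A₀ s) (hij : s.i < s.j) :
    (exchangeStep m s).A =
      rotateAux (s.A s.i) (rotateAux (s.A s.j) s.A (s.i :: s.leftBorders m (s.A s.j)))
        (s.j :: s.rightBorders m (s.A s.i)) :=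
  rotateAux_append _ _ _ _ _ _ fun h => hij.not_ge (hs.leftBorders_subset _ h).2

theorem exchangeStep (hs : Partitioned k m n A₀ s) (hij : s.i < s.j) (hi : m ≤ s.A s.i)
    (hj : s.A s.j < m) : Partitioned k m n A₀ (exchangeStep m s) := by
  have hA := hs.exchangeStep_A hij
  have hi' : (MultiPivot.exchangeStep m s).i = s.i + 1 := rfl
  have hj' : (MultiPivot.exchangeStep m s).j = s.j - 1 := rfl
  have hle := hs.le_i
  constructor <;> simp only [hA, hi', hj', exchangeStep_b]
  · omega
  · exact (Nat.sub_le _ _).trans hs.j_le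
  · omega
  · intro c hc hci
    rw [hs.rotateAux_right_of_lt (by omega)]
    exact hs.rotateAux_left hj c ⟨hc, Nat.le_of_lt_succ hci⟩
  · intro c hjc hc
    refine hs.rotateAux_right hi (fun d hjd hd => ?_) c ⟨by omega, hc⟩
    rw [hs.rotateAux_left_of_gt (hij.trans hjd)]
    exact hs.right d hjd hd
  · intro c hic hcj
    rw [hs.rotateAux_right_of_lt (by omega), hs.rotateAux_left_of_gt hic]
    exact hs.unread c (by omega) (by omega)
  · intro t ht
    have := hs.border_left t ht
    simp only [Set.mem_Icc] at *
    split_ifs <;> omega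
  · intro t ht
    have := hs.border_right t ht
    simp only [Set.mem_Icc] at *
    split_ifs <;> omega

end Partitioned

/-- One step of `Exchange_k`: an execution of the body of an inner loop, or an exchange. -/
inductive Step (m : ℕ) : State → State → Prop
  | left {s : State} (hij : s.i ≤ s.j) (hi : s.A s.i < m) : Step m s (bodyI m s)
  | right {s : State} (hij : s.i ≤ s.j) (hj : m ≤ s.A s.j) : Step m s (bodyJ m s)
  | exchange {s : State} (hij : s.i < s.j) (hi : m ≤ s.A s.i) (hj : s.A s.j < m) :
      Step m s (exchangeStep m s)

section Reachability

variable {k m n : ℕ} {A₀ : ℕ → ℕ} {s s' : State}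

theorem Partitioned.step (hs : Partitioned k m n A₀ s) (h : Step m s s') :
    Partitioned k m n A₀ s' := by
  cases h with
  | left hij hi => exact hs.bodyI hij hi
  | right hij hj => exact hs.bodyJ hij hj
  | exchange hij hi hj => exact hs.exchangeStep hij hi hj

theorem Partitioned.of_reflTransGen (hs : Partitioned k m n A₀ s)
    (h : Relation.ReflTransGen (Step m) s s') : Partitioned k m n A₀ s' := by
  induction h with
  | refl => exact hs
  | tail _ hstep ih => exact ih.step hstep

theorem reflTransGen_loopI (hs : Partitioned k m n A₀ s) :
    Relation.ReflTransGen (Step m) s (loopI m n s) := by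
  induction s using loopI.induct m n with
  | case1 s h ih =>
    have hij : s.i ≤ s.j := not_lt.mp fun hji => (hs.right s.i hji h.1).not_gt h.2
    rw [loopI, if_pos h]
    exact .head (.left hij h.2) (ih (hs.bodyI hij h.2))
  | case2 s h => rw [loopI, if_neg h]

theorem reflTransGen_loopJ (hs : Partitioned k m n A₀ s) :
    Relation.ReflTransGen (Step m) s (loopJ k m s) := by
  induction s using loopJ.induct k m with
  | case1 s h ih =>
    have hij : s.i ≤ s.j := not_lt.mp fun hji => (hs.left s.j h.1 hji).not_ge h.2
    rw [loopJ, if_pos h]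
    exact .head (.right hij h.2) (ih (hs.bodyJ hij h.2))
  | case2 s h => rw [loopJ, if_neg h]

theorem loopI_exit : ¬((loopI m n s).i ≤ n ∧ (loopI m n s).A (loopI m n s).i < m) := by
  induction s using loopI.induct m n with
  | case1 s h ih => rwa [loopI, if_pos h]
  | case2 s h => rwa [loopI, if_neg h]

theorem loopJ_exit : ¬(k < (loopJ k m s).j ∧ m ≤ (loopJ k m s).A (loopJ k m s).j) := by
  induction s using loopJ.induct k m with
  | case1 s h ih => rwa [loopJ, if_pos h]
  | case2 s h => rwa [loopJ, if_neg h]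

theorem reflTransGen_outerBody (hs : Partitioned k m n A₀ s) :
    Relation.ReflTransGen (Step m) s (outerBody k m n s) := by
  have hI := reflTransGen_loopI hs
  have hsI := hs.of_reflTransGen hI
  have hJ := reflTransGen_loopJ hsI
  have hsJ := hsI.of_reflTransGen hJ
  rw [outerBody]
  split
  case isFalse => exact hI.trans hJ
  case isTrue hij =>
    have hptr := loopJ_pointers k m (loopI m n s)
    refine (hI.trans hJ).tail (.exchange hij ?_ ?_)
    · rw [hsJ.unread _ le_rfl hij.le, hptr.1, ← hsI.unread _ le_rfl (by omega)]
      have := loopI_exit (m := m) (n := n) (s := s)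
      have := hsI.j_le
      omega
    · have := loopJ_exit (k := k) (m := m) (s := loopI m n s)
      have := hsJ.le_i
      omega

theorem reflTransGen_outerLoop (hs : Partitioned k m n A₀ s) :
    Relation.ReflTransGen (Step m) s (outerLoop k m n s) := by
  induction s using outerLoop.induct k m n with
  | case1 s h ih =>
    have hbody := reflTransGen_outerBody hs
    rw [outerLoop, if_pos h]
    exact hbody.trans (ih (hs.of_reflTransGen hbody))
  | case2 s h => rw [outerLoop, if_neg h]

theorem outerLoop_j_le_i : (outerLoop k m n s).j ≤ (outerLoop k m n s).i := by
  induction s using outerLoop.induct k m n with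
  | case1 s h ih => rwa [outerLoop, if_pos h]
  | case2 s h => rw [outerLoop, if_neg h]; exact not_lt.mp h

theorem reflTransGen_exchange (hn : k + 1 ≤ n) :
    Relation.ReflTransGen (Step (numLeft k)) (initState k n A₀) (exchange k n A₀) :=
  reflTransGen_outerLoop (.initState (A₀ := A₀) hn)

end Reachability

open scoped Finset

/-- The sum of `fl` over the groups of the cells `k + 1, …, i - 1` and of `fr` over the groups of
the cells `j + 1, …, n`: the amount charged to the elements read so far, if an element of group `g`
is charged `fl g` when it is read by pointer `i` and `fr g` when it is read by pointer `j`. -/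
def splitSum (k n : ℕ) (A₀ fl fr : ℕ → ℕ) (i j : ℕ) : ℕ :=
  ∑ c ∈ Finset.Ico (k + 1) i, fl (A₀ c) + ∑ c ∈ Finset.Ico (j + 1) (n + 1), fr (A₀ c)

section SplitSum

variable {k n : ℕ} {A₀ fl fr : ℕ → ℕ} {i j : ℕ}

theorem splitSum_init : splitSum k n A₀ fl fr (k + 1) n = 0 := by
  simp only [splitSum, Finset.Ico_self, Finset.sum_empty, add_zero]

theorem splitSum_succ_left (hi : k + 1 ≤ i) :
    splitSum k n A₀ fl fr (i + 1) j = splitSum k n A₀ fl fr i j + fl (A₀ i) := by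
  rw [splitSum, Finset.sum_Ico_succ_top hi, splitSum, add_right_comm]

theorem splitSum_pred_right (hj : 1 ≤ j) (hjn : j ≤ n) :
    splitSum k n A₀ fl fr i (j - 1) = splitSum k n A₀ fl fr i j + fr (A₀ j) := by
  rw [splitSum, Nat.sub_add_cancel hj, Finset.sum_eq_sum_Ico_succ_bot (Nat.lt_succ_of_le hjn),
    splitSum, add_assoc, add_comm (fr _)]

end SplitSum

/-- The quantity `f` of the memory grows by `fl g` whenever pointer `i` reads an element of group
`g`, and by `fr g` whenever pointer `j` does; an exchange step reads one element with each. -/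
structure Tally (k m n : ℕ) (f : State → ℕ) (fl fr : ℕ → ℕ) : Prop where
  left : ∀ {A₀ s}, Partitioned k m n A₀ s → s.i ≤ s.j → s.A s.i < m →
    f (bodyI m s) = f s + fl (s.A s.i)
  right : ∀ {A₀ s}, Partitioned k m n A₀ s → s.i ≤ s.j → m ≤ s.A s.j →
    f (bodyJ m s) = f s + fr (s.A s.j)
  exchange : ∀ {A₀ s}, Partitioned k m n A₀ s → s.i < s.j → m ≤ s.A s.i → s.A s.j < m →
    f (exchangeStep m s) = f s + fl (s.A s.i) + fr (s.A s.j)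

namespace Tally

variable {k m n : ℕ} {f f' : State → ℕ} {fl fl' fr fr' : ℕ → ℕ} {A₀ : ℕ → ℕ} {s s' : State}

theorem add (hf : Tally k m n f fl fr) (hf' : Tally k m n f' fl' fr') :
    Tally k m n (fun s => f s + f' s) (fun g => fl g + fl' g) (fun g => fr g + fr' g) where
  left hs hij hi := by simp only [hf.left hs hij hi, hf'.left hs hij hi]; ring
  right hs hij hj := by simp only [hf.right hs hij hj, hf'.right hs hij hj]; ring
  exchange hs hij hi hj := by
    simp only [hf.exchange hs hij hi hj, hf'.exchange hs hij hi hj]; ring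

theorem sum {ι : Type*} (T : Finset ι) {f : ι → State → ℕ} {fl fr : ι → ℕ → ℕ}
    (hf : ∀ t, Tally k m n (f t) (fl t) (fr t)) :
    Tally k m n (fun s => ∑ t ∈ T, f t s) (fun g => ∑ t ∈ T, fl t g)
      (fun g => ∑ t ∈ T, fr t g) where
  left hs hij hi := by simp only [(hf _).left hs hij hi, Finset.sum_add_distrib]
  right hs hij hj := by simp only [(hf _).right hs hij hj, Finset.sum_add_distrib]
  exchange hs hij hi hj := by simp only [(hf _).exchange hs hij hi hj, Finset.sum_add_distrib]

theorem step (hf : Tally k m n f fl fr) (hs : Partitioned k m n A₀ s) (h : Step m s s')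
    (hfs : f s = splitSum k n A₀ fl fr s.i s.j) : f s' = splitSum k n A₀ fl fr s'.i s'.j := by
  have hle := hs.le_i
  have hjn := hs.j_le
  cases h with
  | left hij hi =>
    rw [hf.left hs hij hi, bodyI_i, bodyI_j, splitSum_succ_left hle, hfs, hs.unread _ le_rfl hij]
  | right hij hj =>
    rw [hf.right hs hij hj, bodyJ_i, bodyJ_j, splitSum_pred_right (by omega) hjn, hfs,
      hs.unread _ hij le_rfl]
  | exchange hij hi hj =>
    change _ = splitSum k n A₀ fl fr (s.i + 1) (s.j - 1)
    rw [hf.exchange hs hij hi hj, splitSum_pred_right (by omega) hjn, splitSum_succ_left hle, hfs,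
      hs.unread _ le_rfl hij.le, hs.unread _ hij.le le_rfl]

theorem of_reflTransGen (hf : Tally k m n f fl fr) (hs : Partitioned k m n A₀ s)
    (h : Relation.ReflTransGen (Step m) s s') (hfs : f s = splitSum k n A₀ fl fr s.i s.j) :
    f s' = splitSum k n A₀ fl fr s'.i s'.j := by
  induction h with
  | refl => exact hfs
  | tail hreach hstep ih => exact hf.step (hs.of_reflTransGen hreach) hstep ih

theorem exchange_eq (hf : Tally k (numLeft k) n f fl fr) (hn : k + 1 ≤ n)
    (hf₀ : f (initState k n A₀) = 0) :
    f (MultiPivot.exchange k n A₀) =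
      splitSum k n A₀ fl fr (MultiPivot.exchange k n A₀).i (MultiPivot.exchange k n A₀).j :=
  hf.of_reflTransGen (.initState hn) (reflTransGen_exchange hn) (hf₀.trans splitSum_init.symm)

theorem pointer_i :
    Tally k m n (fun s => pointerCost (k + 1) s.i) (fun g => if g < m then 1 else 0)
      (fun g => if g < m then 1 else 0) where
  left hs _ hi := by
    have := hs.le_i
    rw [bodyI_i, if_pos hi]
    simp only [pointerCost]
    omega
  right _ _ hj := by rw [bodyJ_i, if_neg hj.not_gt, add_zero]
  exchange {_ s} hs _ hi hj := by
    have := hs.le_i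
    rw [if_neg hi.not_gt, if_pos hj]
    change pointerCost (k + 1) (s.i + 1) = _
    simp only [pointerCost]
    omega

theorem pointer_j :
    Tally k m n (fun s => pointerCost n s.j) (fun g => if m ≤ g then 1 else 0)
      (fun g => if m ≤ g then 1 else 0) where
  left _ _ hi := by rw [bodyI_j, if_neg hi.not_ge, add_zero]
  right hs hij hj := by
    have := hs.le_i
    have := hs.j_le
    rw [bodyJ_j, if_pos hj]
    simp only [pointerCost]
    omega
  exchange {_ s} hs _ hi hj := by
    have := hs.le_i
    have := hs.j_le
    rw [if_pos hi, if_neg hj.not_ge]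
    change pointerCost n (s.j - 1) = _
    simp only [pointerCost]
    omega

theorem border (t : ℕ) :
    Tally k m n (fun s => pointerCost (if t < m then k + 1 else n) (s.b t))
      (fun g => if g < t ∧ t < m ∨ m ≤ t ∧ t < g then 1 else 0)
      (fun g => if g < t ∧ t < m ∨ m ≤ t ∧ t < g then 1 else 0) where
  left hs _ hi := by
    have := hs.border_left t
    simp only [bodyI_b, pointerCost, Set.mem_Icc] at *
    split_ifs <;> omega
  right hs hij hj := by
    have := hs.le_i
    have := hs.border_right t
    simp only [bodyJ_b, pointerCost, Set.mem_Icc] at *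
    split_ifs <;> omega
  exchange hs hij hi hj := by
    have := hs.le_i
    have hl := hs.border_left t
    have hr := hs.border_right t
    simp only [exchangeStep_b, pointerCost, Set.mem_Icc] at *
    split_ifs <;> omega

end Tally

/-- The number of pointers that pass an element of group `g`: one of `i` and `j`, and the borders
between its final place and the place where `i` and `j` meet. -/
def visits (m g : ℕ) : ℕ := if g < m then m - g else g - m + 1

/-- The number of write accesses charged to an element of group `g` that is read by pointer `i`. An
element of group `A_{m-1}` stays where it is. -/
def writesLeft (m g : ℕ) : ℕ := if g + 1 = m then 0 else visits m g

/-- The number of write accesses charged to an element of group `g` that is read by pointer `j`. An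
element of group `A_m` stays where it is. -/
def writesRight (m g : ℕ) : ℕ := if g = m then 0 else visits m g

/-- The number of assignments charged to an element of group `g` that is read by pointer `i`. A
rotation has one more assignment than write accesses, and the one of an exchange step is charged to
the element read by pointer `j`. -/
def assignsLeft (m g : ℕ) : ℕ := writesLeft m g + if g + 1 < m then 1 else 0

/-- The number of assignments charged to an element of group `g` that is read by pointer `j`. -/
def assignsRight (m g : ℕ) : ℕ := writesRight m g + if g = m then 0 else 1

/-- The cost, summed over all pointers, of scanning an element of group `g`. -/
def scans (k m g : ℕ) : ℕ :=
  1 + ∑ t ∈ Finset.Icc 1 (k - 1), if g < t ∧ t < m ∨ m ≤ t ∧ t < g then 1 else 0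

theorem scans_eq_visits {k m g : ℕ} (hm : 1 ≤ m) (hmk : m ≤ k) (hg : g ≤ k) :
    scans k m g = visits m g := by
  rw [scans, ← Finset.card_filter, visits]
  split
  case isTrue h =>
    have : {t ∈ Finset.Icc 1 (k - 1) | g < t ∧ t < m ∨ m ≤ t ∧ t < g} = Finset.Ioo g m := by
      ext t; simp only [Finset.mem_filter, Finset.mem_Icc, Finset.mem_Ioo]; omega
    rw [this, Nat.card_Ioo]; omega
  case isFalse h =>
    have : {t ∈ Finset.Icc 1 (k - 1) | g < t ∧ t < m ∨ m ≤ t ∧ t < g} = Finset.Ico m g := by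
      ext t; simp only [Finset.mem_filter, Finset.mem_Icc, Finset.mem_Ico]; omega
    rw [this, Nat.card_Ico, add_comm]

namespace Tally

variable {k m n : ℕ}

theorem scanned :
    Tally k m n (fun s => pointerCost (k + 1) s.i + pointerCost n s.j +
      ∑ t ∈ Finset.Icc 1 (k - 1), pointerCost (if t < m then k + 1 else n) (s.b t))
      (scans k m) (scans k m) := by
  have h := (pointer_i.add pointer_j).add
    (sum (Finset.Icc 1 (k - 1)) (border (k := k) (m := m) (n := n)))
  have hone : ∀ g, (if g < m then 1 else 0) + (if m ≤ g then 1 else 0) = 1 := fun g => by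
    split_ifs <;> omega
  simp only [hone] at h
  exact h

theorem writes : Tally k m n State.writes (writesLeft m) (writesRight m) where
  left _ _ hi := by
    rw [bodyI_writes, writesLeft, visits]
    split_ifs <;> omega
  right _ _ hj := by
    rw [bodyJ_writes, writesRight, visits]
    split_ifs <;> omega
  exchange _ _ hi hj := by
    rw [exchangeStep_writes hi hj, writesLeft, writesRight, visits, visits]
    split_ifs <;> omega

theorem assigns : Tally k m n State.assigns (assignsLeft m) (assignsRight m) where
  left _ _ hi := by
    rw [bodyI_assigns, assignsLeft, writesLeft, visits]
    split_ifs <;> omega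
  right _ _ hj := by
    rw [bodyJ_assigns, assignsRight, writesRight, visits]
    split_ifs <;> omega
  exchange _ _ hi hj := by
    rw [exchangeStep_assigns hi hj, assignsLeft, assignsRight, writesLeft, writesRight, visits,
      visits]
    split_ifs <;> omega

end Tally

/-- The number of elements of the groups `A_0, …, A_{m-1}`. -/
def numSmall (k m n : ℕ) (A₀ : ℕ → ℕ) : ℕ :=
  ∑ c ∈ Finset.Ico (k + 1) (n + 1), if A₀ c < m then 1 else 0

/-- The amount charged if pointer `i` reads exactly the first `numSmall k m n A₀` cells after the
pivots and pointer `j` reads the rest. -/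
def idealCost (k m n : ℕ) (fl fr A₀ : ℕ → ℕ) : ℕ :=
  ∑ c ∈ Finset.Ico (k + 1) (n + 1),
    if c ≤ k + numSmall k m n A₀ then fl (A₀ c) else fr (A₀ c)

section IdealCost

variable {k m n i j : ℕ} {A₀ fl fr : ℕ → ℕ}

theorem sum_Ico_split {φ : ℕ → ℕ} (hi : k + 1 ≤ i) (hij : i ≤ j + 1) (hjn : j ≤ n) :
    ∑ c ∈ Finset.Ico (k + 1) (n + 1), φ c =
      (∑ c ∈ Finset.Ico (k + 1) i, φ c + ∑ c ∈ Finset.Ico (j + 1) (n + 1), φ c) +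
        ∑ c ∈ Finset.Ico i (j + 1), φ c := by
  rw [← Finset.sum_Ico_consecutive φ hi (by omega : i ≤ n + 1),
    ← Finset.sum_Ico_consecutive φ hij (by omega : j + 1 ≤ n + 1)]
  ring

theorem idealCost_eq_splitSum_add (hi : k + 1 ≤ i) (hij : i ≤ j + 1) (hjn : j ≤ n)
    (hil : i ≤ k + numSmall k m n A₀ + 1) (hlj : k + numSmall k m n A₀ ≤ j) :
    idealCost k m n fl fr A₀ = splitSum k n A₀ fl fr i j +
      ∑ c ∈ Finset.Ico i (j + 1),
        if c ≤ k + numSmall k m n A₀ then fl (A₀ c) else fr (A₀ c) := by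
  rw [idealCost, sum_Ico_split hi hij hjn, splitSum]
  congr 2
  · refine Finset.sum_congr rfl fun c hc => if_pos ?_
    have := (Finset.mem_Ico.mp hc).2
    omega
  · refine Finset.sum_congr rfl fun c hc => if_neg ?_
    have := (Finset.mem_Ico.mp hc).1
    omega

theorem numSmall_eq_splitSum_add (hi : k + 1 ≤ i) (hij : i ≤ j + 1) (hjn : j ≤ n) :
    numSmall k m n A₀ =
      splitSum k n A₀ (fun g => if g < m then 1 else 0) (fun g => if g < m then 1 else 0) i j +
        #{c ∈ Finset.Ico i (j + 1) | A₀ c < m} := by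
  rw [numSmall, sum_Ico_split hi hij hjn, splitSum, Finset.card_filter]

theorem idealCost_mem_Icc {B : ℕ} (hB : ∀ c, fl (A₀ c) ≤ B ∧ fr (A₀ c) ≤ B)
    (hi : k + 1 ≤ i) (hij : i ≤ j + 1) (hji : j ≤ i) (hjn : j ≤ n)
    (hbalance : i = k + 1 + splitSum k n A₀ (fun g => if g < m then 1 else 0)
      (fun g => if g < m then 1 else 0) i j) :
    idealCost k m n fl fr A₀ ∈
      Set.Icc (splitSum k n A₀ fl fr i j) (splitSum k n A₀ fl fr i j + B) := by
  have hnum := numSmall_eq_splitSum_add (m := m) (A₀ := A₀) hi hij hjn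
  have hcard : #{c ∈ Finset.Ico i (j + 1) | A₀ c < m} ≤ j + 1 - i :=
    (Finset.card_filter_le _ _).trans_eq (Nat.card_Ico _ _)
  have hmiddle : (∑ c ∈ Finset.Ico i (j + 1),
      if c ≤ k + numSmall k m n A₀ then fl (A₀ c) else fr (A₀ c)) ≤ (j + 1 - i) * B := by
    rw [← Nat.card_Ico, ← smul_eq_mul]
    exact Finset.sum_le_card_nsmul _ _ _ fun c _ => by split_ifs; exacts [(hB c).1, (hB c).2]
  have hunread : (j + 1 - i) * B ≤ B := mul_le_of_le_one_left B.zero_le (by omega)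
  rw [idealCost_eq_splitSum_add hi hij hjn (by omega) (by omega)]
  exact ⟨Nat.le_add_right _ _, by gcongr; exact hmiddle.trans hunread⟩

theorem Tally.idealCost_exchange {f : State → ℕ} (hf : Tally k (numLeft k) n f fl fr)
    (hn : k + 1 ≤ n) (hf₀ : f (initState k n A₀) = 0) {B : ℕ}
    (hB : ∀ c, fl (A₀ c) ≤ B ∧ fr (A₀ c) ≤ B) :
    idealCost k (numLeft k) n fl fr A₀ ∈
      Set.Icc (f (MultiPivot.exchange k n A₀)) (f (MultiPivot.exchange k n A₀) + B) := by
  have hs := (Partitioned.initState (A₀ := A₀) hn).of_reflTransGen (reflTransGen_exchange hn)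
  have hbalance := (Tally.pointer_i (m := numLeft k)).exchange_eq (A₀ := A₀) hn (by
    simp only [initState, pointerCost, sub_self, Int.natAbs_zero])
  have hle := hs.le_i
  rw [hf.exchange_eq hn hf₀]
  refine idealCost_mem_Icc hB hle hs.i_le outerLoop_j_le_i hs.j_le ?_
  rw [← hbalance, pointerCost]
  omega

end IdealCost

open Finset
open scoped BigOperators

/-- The number of positions in `T` whose value is smaller than the value at `x`. -/
def rank {α β : Type*} [LinearOrder β] (T : Finset α) (f : α → β) (x : α) : ℕ :=
  #{r ∈ T | f r < f x}

section Rank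

variable {α β : Type*} [LinearOrder β] {T : Finset α} {f : α → β} {x y : α}

theorem rank_lt_rank (hx : x ∈ T) (h : f x < f y) : rank T f x < rank T f y := by
  have hsubset : {r ∈ T | f r < f x} ⊆ {r ∈ T | f r < f y} :=
    monotone_filter_right T fun r _ hr => hr.trans h
  refine card_lt_card ((ssubset_iff_of_subset hsubset).mpr ⟨x, ?_, ?_⟩)
  · exact mem_filter.mpr ⟨hx, h⟩
  · simp only [mem_filter, lt_self_iff_false, and_false, not_false_eq_true]

theorem rank_lt_rank_iff (hx : x ∈ T) (hy : y ∈ T) : rank T f x < rank T f y ↔ f x < f y := by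
  refine ⟨fun h => lt_of_not_ge fun hyx => ?_, rank_lt_rank hx⟩
  obtain hyx | hyx := hyx.eq_or_lt
  · simp only [rank, hyx, lt_self_iff_false] at h
  · exact h.not_gt (rank_lt_rank hy hyx)

theorem rank_lt_card (hx : x ∈ T) : rank T f x < #T :=
  card_lt_card (filter_ssubset.mpr ⟨x, hx, lt_irrefl _⟩)

theorem rank_injOn (hf : Function.Injective f) : Set.InjOn (rank T f) T := by
  intro x hx y hy h
  by_contra hne
  obtain hlt | hlt := (hf.ne hne).lt_or_gt
  · exact (rank_lt_rank hx hlt).ne h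
  · exact (rank_lt_rank hy hlt).ne' h

theorem image_rank (hf : Function.Injective f) : T.image (rank T f) = range #T := by
  refine eq_of_subset_of_card_le (fun u hu => ?_) ?_
  · obtain ⟨x, hx, rfl⟩ := mem_image.mp hu
    exact mem_range.mpr (rank_lt_card hx)
  · rw [card_range, card_image_of_injOn (rank_injOn hf)]

theorem rank_insert [DecidableEq α] (hy : y ∉ T) :
    rank (insert y T) f x = rank T f x + if f y < f x then 1 else 0 := by
  simp only [rank, filter_insert]
  split
  · rw [card_insert_of_notMem fun h => hy (mem_filter.mp h).1]
  · rw [add_zero]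

theorem rank_comp_perm {π : Equiv.Perm α} (hπ : ∀ r, π r ∈ T ↔ r ∈ T) :
    rank T (f ∘ π) x = rank T f (π x) :=
  card_equiv π fun r => by simp only [mem_filter, hπ, Function.comp_apply]

theorem expect_offDiag_rank (hf : Function.Injective f) (ψ : ℕ → ℕ → ℝ) :
    𝔼 u ∈ T.offDiag, ψ (rank T f u.1) (rank T f u.2) =
      𝔼 w ∈ (range #T).offDiag, ψ w.1 w.2 := by
  have hrank := rank_injOn (T := T) hf
  have himage := image_rank (T := T) hf
  refine expect_nbij (Prod.map (rank T f) (rank T f)) ?_ (fun _ _ => rfl) ?_ ?_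
  · rintro ⟨x, y⟩ hxy
    obtain ⟨hx, hy, hne⟩ := mem_offDiag.mp hxy
    exact mem_offDiag.mpr ⟨mem_range.mpr (rank_lt_card hx), mem_range.mpr (rank_lt_card hy),
      hrank.ne hx hy hne⟩
  · rintro ⟨x, y⟩ hxy ⟨x', y'⟩ hxy' h
    obtain ⟨hx, hy, -⟩ := mem_offDiag.mp (mem_coe.mp hxy)
    obtain ⟨hx', hy', -⟩ := mem_offDiag.mp (mem_coe.mp hxy')
    obtain ⟨h₁, h₂⟩ := Prod.mk.inj h
    exact Prod.ext (hrank hx hx' h₁) (hrank hy hy' h₂)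
  · rintro ⟨u, v⟩ huv
    rw [mem_coe, mem_offDiag, ← himage] at huv
    obtain ⟨hu, hv, hne⟩ := huv
    obtain ⟨x, hx, rfl⟩ := mem_image.mp hu
    obtain ⟨y, hy, rfl⟩ := mem_image.mp hv
    have hxy : x ≠ y := fun h => hne (congrArg (rank T f) h)
    exact ⟨(x, y), mem_coe.mpr (mem_offDiag.mpr ⟨hx, hy, hxy⟩), rfl⟩

end Rank

section Uniform

variable {α : Type*} {T : Finset α} {x y x' y' : α}

theorem exists_perm_mapsTo_pair (hx : x ∈ T) (hy : y ∈ T) (hxy : x ≠ y) (hx' : x' ∈ T)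
    (hy' : y' ∈ T) (hxy' : x' ≠ y') :
    ∃ π : Equiv.Perm α, (∀ r, π r ∈ T ↔ r ∈ T) ∧ π x = x' ∧ π y = y' := by
  classical
  obtain ⟨π, hπx, hπy⟩ := MulAction.is_two_pretransitive_iff.mp
    (Equiv.Perm.isMultiplyPretransitive {r // r ∈ T} 2)
    (show (⟨x, hx⟩ : {r // r ∈ T}) ≠ ⟨y, hy⟩ from Subtype.coe_ne_coe.mp hxy)
    (show (⟨x', hx'⟩ : {r // r ∈ T}) ≠ ⟨y', hy'⟩ from Subtype.coe_ne_coe.mp hxy')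
  refine ⟨Equiv.Perm.ofSubtype π, Equiv.Perm.ofSubtype_apply_mem_iff_mem π, ?_, ?_⟩
  · rw [Equiv.Perm.ofSubtype_apply_of_mem π hx]
    exact congrArg Subtype.val hπx
  · rw [Equiv.Perm.ofSubtype_apply_of_mem π hy]
    exact congrArg Subtype.val hπy

/- By symmetry the average does not depend on the pair of positions, so it equals the average over
all pairs, and for each `σ` the ranks of these run through all pairs of distinct numbers. -/
theorem expect_perm_rank [Fintype α] [LinearOrder α] (hx : x ∈ T) (hy : y ∈ T) (hxy : x ≠ y)
    (ψ : ℕ → ℕ → ℝ) :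
    𝔼 σ : Equiv.Perm α, ψ (rank T σ x) (rank T σ y) =
      𝔼 w ∈ (range #T).offDiag, ψ w.1 w.2 := by
  have hsymm : ∀ u ∈ T.offDiag, 𝔼 σ : Equiv.Perm α, ψ (rank T σ u.1) (rank T σ u.2) =
      𝔼 σ : Equiv.Perm α, ψ (rank T σ x) (rank T σ y) := by
    intro u hu
    rw [mem_offDiag] at hu
    obtain ⟨π, hπ, hπx, hπy⟩ := exists_perm_mapsTo_pair hx hy hxy hu.1 hu.2.1 hu.2.2
    refine Fintype.expect_equiv (Equiv.mulRight π) _ _ fun σ => ?_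
    rw [Equiv.coe_mulRight, Equiv.Perm.coe_mul, rank_comp_perm hπ, rank_comp_perm hπ, hπx, hπy]
  have hne : T.offDiag.Nonempty := ⟨(x, y), mem_offDiag.mpr ⟨hx, hy, hxy⟩⟩
  rw [← expect_const hne (𝔼 σ : Equiv.Perm α, ψ (rank T σ x) (rank T σ y)),
    ← expect_congr rfl hsymm, expect_comm]
  simp only [expect_offDiag_rank (Equiv.injective _), Fintype.expect_const]

end Uniform

theorem sum_offDiag_ite_lt {α : Type*} [LinearOrder α] (T : Finset α) (ψ χ : α → α → ℝ) :
    ∑ w ∈ T.offDiag, (if w.2 < w.1 then ψ w.1 w.2 else χ w.1 w.2) =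
      ∑ u ∈ T, ∑ v ∈ T, (if v < u then ψ u v else 0) +
        ∑ u ∈ T, ∑ v ∈ T, (if u < v then χ u v else 0) := by
  have hoffDiag : T.offDiag = {w ∈ T ×ˢ T | w.1 ≠ w.2} := by
    ext w; simp only [mem_offDiag, mem_filter, mem_product, and_assoc]
  rw [hoffDiag, sum_filter, sum_product, ← sum_add_distrib]
  refine sum_congr rfl fun u _ => ?_
  rw [← sum_add_distrib]
  refine sum_congr rfl fun v _ => ?_
  obtain h | h | h := lt_trichotomy u v
  · simp only [h, h.ne, h.not_gt, ne_eq, not_false_eq_true, if_true, if_false, zero_add]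
  · simp only [h, ne_eq, not_true_eq_false, if_false, lt_self_iff_false, add_zero]
  · simp only [h, h.ne', h.not_gt, ne_eq, not_false_eq_true, if_true, if_false, add_zero]

theorem sum_offDiag_range_shift (k : ℕ) (φ : ℕ → ℕ → ℝ) :
    ∑ w ∈ (range (k + 2)).offDiag, (if w.2 < w.1 then φ (w.1 - 1) w.2 else φ w.1 (w.2 - 1)) =
      ∑ g ∈ range (k + 1), ∑ h ∈ range (k + 1), φ g h + ∑ g ∈ range (k + 1), φ g g := by
  have hlower : ∑ u ∈ range (k + 2), ∑ v ∈ range (k + 2), (if v < u then φ (u - 1) v else 0) =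
      ∑ g ∈ range (k + 1), ∑ h ∈ range (k + 1), if h ≤ g then φ g h else 0 := by
    rw [sum_range_succ']
    simp only [not_lt_zero, if_false, sum_const_zero, add_zero, Nat.add_sub_cancel]
    refine sum_congr rfl fun g hg => ?_
    rw [sum_range_succ, if_neg (not_lt_of_ge (mem_range.mp hg)), add_zero]
    simp only [Nat.lt_succ_iff]
  have hupper : ∑ u ∈ range (k + 2), ∑ v ∈ range (k + 2), (if u < v then φ u (v - 1) else 0) =
      ∑ g ∈ range (k + 1), ∑ h ∈ range (k + 1), if g ≤ h then φ g h else 0 := by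
    rw [sum_comm, sum_range_succ', sum_comm (s := range (k + 1)) (t := range (k + 1))]
    simp only [not_lt_zero, if_false, sum_const_zero, add_zero, Nat.add_sub_cancel]
    refine sum_congr rfl fun h hh => ?_
    rw [sum_range_succ, if_neg (not_lt_of_ge (mem_range.mp hh)), add_zero]
    simp only [Nat.lt_succ_iff]
  have hdiag : ∑ g ∈ range (k + 1), φ g g =
      ∑ g ∈ range (k + 1), ∑ h ∈ range (k + 1), if g = h then φ g h else 0 :=
    sum_congr rfl fun g hg => by rw [sum_ite_eq, if_pos hg]
  rw [sum_offDiag_ite_lt (ψ := fun u v => φ (u - 1) v) (χ := fun u v => φ u (v - 1)), hlower,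
    hupper, hdiag]
  simp only [← sum_add_distrib]
  refine sum_congr rfl fun g _ => sum_congr rfl fun h _ => ?_
  obtain hgh | hgh | hgh := lt_trichotomy g h
  · simp only [hgh.le, hgh.ne, hgh.not_ge, if_true, if_false, zero_add, add_zero]
  · simp only [hgh, le_refl, if_true]
  · simp only [hgh.le, hgh.ne', hgh.not_ge, if_true, if_false, add_zero]

theorem rank_pair_eq_ite {α β : Type*} [LinearOrder α] [LinearOrder β] {P : Finset α} {x y : α}
    {f : α → β} (hf : Function.Injective f) (hx : x ∉ P) (hy : y ∉ P) (hxy : x ≠ y)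
    (φ : ℕ → ℕ → ℝ) :
    φ (rank P f x) (rank P f y) =
      if rank (insert x (insert y P)) f y < rank (insert x (insert y P)) f x then
        φ (rank (insert x (insert y P)) f x - 1) (rank (insert x (insert y P)) f y)
      else φ (rank (insert x (insert y P)) f x) (rank (insert x (insert y P)) f y - 1) := by
  have hx' : x ∉ insert y P := fun h => (mem_insert.mp h).elim hxy hx
  simp only [rank_lt_rank_iff (mem_insert_of_mem (mem_insert_self y P)) (mem_insert_self x _)]
  simp only [rank_insert hx', rank_insert hy, lt_self_iff_false, if_false, add_zero]
  obtain h | h := (hf.ne hxy).lt_or_gt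
  · simp only [h, h.not_gt, if_true, if_false, add_zero, Nat.add_sub_cancel]
  · simp only [h, h.not_gt, if_true, if_false, add_zero, Nat.add_sub_cancel]

/- Insert `x` and `y` into `P` one after the other: there are `#P + 1` gaps for the first one, and
`#P + 2` for the second one, since the gap of the first one has been cut in two. -/
theorem expect_perm_rank_notMem {α : Type*} [Fintype α] [LinearOrder α] {P : Finset α} {x y : α}
    (hx : x ∉ P) (hy : y ∉ P) (hxy : x ≠ y) (φ : ℕ → ℕ → ℝ) :
    𝔼 σ : Equiv.Perm α, φ (rank P σ x) (rank P σ y) =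
      (∑ g ∈ range (#P + 1), ∑ h ∈ range (#P + 1), φ g h + ∑ g ∈ range (#P + 1), φ g g) /
        ((#P + 1) * (#P + 2)) := by
  have hcard : #(insert x (insert y P)) = #P + 2 := by
    rw [card_insert_of_notMem fun h => (mem_insert.mp h).elim hxy hx, card_insert_of_notMem hy]
  have hpairs : (#(range (#P + 2)).offDiag : ℝ) = (#P + 1) * (#P + 2) := by
    rw [offDiag_card, card_range, ← Nat.mul_sub_one]
    push_cast
    ring
  simp only [rank_pair_eq_ite (Equiv.injective _) hx hy hxy]
  rw [expect_perm_rank (mem_insert_self x _) (mem_insert_of_mem (mem_insert_self y P)) hxy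
    fun u v => if v < u then φ (u - 1) v else φ u (v - 1), hcard, expect_eq_sum_div_card, hpairs,
    sum_offDiag_range_shift]

/-- The positions of the pivots `e_1, …, e_k`. -/
def pivots (k n : ℕ) : Finset (Fin n) := {r | r.val < k}

section InputArray

variable {k m n : ℕ} {σ : Equiv.Perm (Fin n)} {c d : ℕ}

theorem mem_pivots {x : Fin n} : x ∈ pivots k n ↔ x.val < k :=
  mem_filter_univ x

theorem card_pivots (h : k ≤ n) : #(pivots k n) = k := by
  rw [pivots, Fin.card_filter_val_lt, min_eq_right h]

theorem inputArray_succ (x : Fin n) : inputArray k n σ (x + 1) = rank (pivots k n) σ x := by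
  simp only [inputArray, Nat.add_sub_cancel, x.isLt, dif_pos, rank, pivots, filter_filter]

theorem exists_notMem_pivots_eq_succ (hc : c ∈ Ico (k + 1) (n + 1)) :
    ∃ x : Fin n, x ∉ pivots k n ∧ c = x + 1 := by
  rw [mem_Ico] at hc
  refine ⟨⟨c - 1, by omega⟩, ?_, ?_⟩
  · rw [mem_pivots, not_lt]
    exact Nat.le_sub_one_of_lt hc.1
  · exact (Nat.sub_add_cancel (by omega)).symm

theorem inputArray_le : inputArray k n σ c ≤ k := by
  rw [inputArray]
  split
  · refine (card_le_card (monotone_filter_right _ fun r _ hr => hr.1)).trans ?_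
    rw [Fin.card_filter_val_lt]
    exact min_le_right n k
  · exact k.zero_le

theorem expect_inputArray_pair (hn : k ≤ n) (hc : c ∈ Ico (k + 1) (n + 1))
    (hd : d ∈ Ico (k + 1) (n + 1)) (hcd : c ≠ d) (φ : ℕ → ℕ → ℝ) :
    𝔼 σ, φ (inputArray k n σ c) (inputArray k n σ d) =
      (∑ g ∈ range (k + 1), ∑ h ∈ range (k + 1), φ g h + ∑ g ∈ range (k + 1), φ g g) /
        ((k + 1) * (k + 2)) := by
  obtain ⟨x, hx, rfl⟩ := exists_notMem_pivots_eq_succ hc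
  obtain ⟨y, hy, rfl⟩ := exists_notMem_pivots_eq_succ hd
  have hxy : x ≠ y := fun h => hcd (by rw [h])
  simp only [inputArray_succ]
  rw [expect_perm_rank_notMem hx hy hxy, card_pivots hn]

theorem exists_perm_inputArray_mul (hc : c ∈ Ico (k + 1) (n + 1)) (hd : d ∈ Ico (k + 1) (n + 1)) :
    ∃ π : Equiv.Perm (Fin n), ∀ σ, ∀ s ∈ Ico (k + 1) (n + 1),
      inputArray k n (σ * π) s = inputArray k n σ (Equiv.swap c d s) := by
  obtain ⟨x, hx, rfl⟩ := exists_notMem_pivots_eq_succ hc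
  obtain ⟨y, hy, rfl⟩ := exists_notMem_pivots_eq_succ hd
  refine ⟨Equiv.swap x y, fun σ s hs => ?_⟩
  obtain ⟨z, -, rfl⟩ := exists_notMem_pivots_eq_succ hs
  have hpivots : ∀ r, Equiv.swap x y r ∈ pivots k n ↔ r ∈ pivots k n := fun r => by
    rw [Equiv.swap_apply_def]
    split_ifs with hrx hry
    · simp only [hrx, hx, hy]
    · simp only [hry, hx, hy]
    · rfl
  have hsucc : Function.Injective fun z : Fin n => (z : ℕ) + 1 :=
    Nat.succ_injective.comp Fin.val_injective
  rw [inputArray_succ, Equiv.Perm.coe_mul, rank_comp_perm hpivots, ← inputArray_succ]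
  exact congrArg _ (hsucc.map_swap x y z)

theorem numSmall_comp_swap {A₀ A₁ : ℕ → ℕ} (hc : c ∈ Ico (k + 1) (n + 1))
    (hd : d ∈ Ico (k + 1) (n + 1))
    (hA : ∀ s ∈ Ico (k + 1) (n + 1), A₁ s = A₀ (Equiv.swap c d s)) :
    numSmall k m n A₁ = numSmall k m n A₀ := by
  refine sum_equiv (Equiv.swap c d) (fun s => ?_) fun s hs => by rw [hA s hs]
  rw [Equiv.swap_apply_def]
  split_ifs with hsc hsd
  · simp only [hsc, hc, hd]
  · simp only [hsd, hc, hd]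
  · rfl

theorem expect_numSmall_inputArray_eq (hc : c ∈ Ico (k + 1) (n + 1))
    (hd : d ∈ Ico (k + 1) (n + 1)) (G : ℕ → ℕ → ℝ) :
    𝔼 σ, G (numSmall k m n (inputArray k n σ)) (inputArray k n σ c) =
      𝔼 σ, G (numSmall k m n (inputArray k n σ)) (inputArray k n σ d) := by
  obtain ⟨π, hπ⟩ := exists_perm_inputArray_mul hc hd
  refine (Fintype.expect_equiv (Equiv.mulRight π) _ _ fun σ => ?_).symm
  rw [Equiv.coe_mulRight, numSmall_comp_swap hc hd (hπ σ), hπ σ c hc, Equiv.swap_apply_left]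

end InputArray

section ExpectedCost

variable {k m n d : ℕ} {fl fr : ℕ → ℕ} {A₀ : ℕ → ℕ}

theorem sum_ite_le_numSmall {M : Type*} [AddCommMonoid M] (u v : M) :
    (∑ c ∈ Ico (k + 1) (n + 1), if c ≤ k + numSmall k m n A₀ then u else v) =
      ∑ c ∈ Ico (k + 1) (n + 1), if A₀ c < m then u else v := by
  have hnum : numSmall k m n A₀ = #{c ∈ Ico (k + 1) (n + 1) | A₀ c < m} := (card_filter _ _).symm
  have hle : #{c ∈ Ico (k + 1) (n + 1) | A₀ c < m} ≤ n + 1 - (k + 1) :=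
    (card_filter_le _ _).trans_eq (Nat.card_Ico _ _)
  have hfirst : {c ∈ Ico (k + 1) (n + 1) | c ≤ k + numSmall k m n A₀} =
      Ico (k + 1) (k + 1 + numSmall k m n A₀) := by
    ext c; simp only [mem_filter, mem_Ico]; omega
  have hcard : #{c ∈ Ico (k + 1) (n + 1) | c ≤ k + numSmall k m n A₀} =
      #{c ∈ Ico (k + 1) (n + 1) | A₀ c < m} := by
    rw [hfirst, Nat.card_Ico, Nat.add_sub_cancel_left, hnum]
  have hcard' : #{c ∈ Ico (k + 1) (n + 1) | ¬c ≤ k + numSmall k m n A₀} =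
      #{c ∈ Ico (k + 1) (n + 1) | ¬A₀ c < m} := by
    rw [filter_not, filter_not, card_sdiff_of_subset (filter_subset _ _),
      card_sdiff_of_subset (filter_subset _ _), hcard]
  simp only [sum_ite, sum_const, hcard, hcard']

theorem expect_idealCost (hd : d ∈ Ico (k + 1) (n + 1)) :
    𝔼 σ, (idealCost k m n fl fr (inputArray k n σ) : ℝ) =
      ∑ c ∈ Ico (k + 1) (n + 1), 𝔼 σ, if inputArray k n σ c < m then
        (fl (inputArray k n σ d) : ℝ) else fr (inputArray k n σ d) := by
  calc 𝔼 σ, (idealCost k m n fl fr (inputArray k n σ) : ℝ)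
      = ∑ c ∈ Ico (k + 1) (n + 1), 𝔼 σ, if c ≤ k + numSmall k m n (inputArray k n σ) then
          (fl (inputArray k n σ c) : ℝ) else fr (inputArray k n σ c) := by
        simp only [idealCost, Nat.cast_sum, Nat.cast_ite, expect_sum_comm]
    _ = ∑ c ∈ Ico (k + 1) (n + 1), 𝔼 σ, if c ≤ k + numSmall k m n (inputArray k n σ) then
          (fl (inputArray k n σ d) : ℝ) else fr (inputArray k n σ d) :=
        sum_congr rfl fun c hc => expect_numSmall_inputArray_eq hc hd fun l g =>
          if c ≤ k + l then (fl g : ℝ) else fr g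
    _ = _ := by simp only [← expect_sum_comm, sum_ite_le_numSmall]

/-- The expected charge of an element of group `g` that is read by pointer `i` if and only if
another element, of group `h`, has `h < m`: the pair `(g, h)` occurs with probability
`(1 + [g = h]) / ((k + 1) (k + 2))`. It is the expected cost of the algorithm per element. -/
noncomputable def rate (k m : ℕ) (fl fr : ℕ → ℕ) : ℝ :=
  (∑ g ∈ range (k + 1), ∑ h ∈ range (k + 1), (if h < m then (fl g : ℝ) else fr g) +
    ∑ g ∈ range (k + 1), if g < m then (fl g : ℝ) else fr g) / ((k + 1) * (k + 2))

theorem expect_idealCost_mem_Icc (hn : k + 1 ≤ n) {B : ℕ} (hB : ∀ g ≤ k, fl g ≤ B ∧ fr g ≤ B) :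
    𝔼 σ, (idealCost k m n fl fr (inputArray k n σ) : ℝ) ∈
      Set.Icc ((n - k - 1) * rate k m fl fr) ((n - k - 1) * rate k m fl fr + B) := by
  have hmem : n ∈ Ico (k + 1) (n + 1) := mem_Ico.mpr ⟨hn, n.lt_succ_self⟩
  have hpair : ∀ c ∈ (Ico (k + 1) (n + 1)).erase n, (𝔼 σ, if inputArray k n σ c < m then
      (fl (inputArray k n σ n) : ℝ) else fr (inputArray k n σ n)) = rate k m fl fr := by
    intro c hc
    obtain ⟨hcn, hc⟩ := mem_erase.mp hc
    rw [expect_inputArray_pair (by omega) hmem hc hcn.symm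
      fun g h => if h < m then (fl g : ℝ) else fr g, rate]
  have hcard : (#((Ico (k + 1) (n + 1)).erase n) : ℝ) = n - k - 1 := by
    rw [card_erase_of_mem hmem, Nat.card_Ico, Nat.add_sub_add_right, Nat.sub_sub, Nat.cast_sub hn,
      Nat.cast_succ, sub_sub]
  have hsame : (𝔼 σ, if inputArray k n σ n < m then (fl (inputArray k n σ n) : ℝ) else
      fr (inputArray k n σ n)) ∈ Set.Icc (0 : ℝ) B := by
    refine ⟨expect_nonneg fun σ _ => by positivity, expect_le univ_nonempty fun σ _ => ?_⟩
    split_ifs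
    exacts [mod_cast (hB _ inputArray_le).1, mod_cast (hB _ inputArray_le).2]
  rw [expect_idealCost hmem, ← sum_erase_add _ _ hmem, sum_congr rfl hpair, sum_const,
    nsmul_eq_mul, hcard]
  exact ⟨le_add_of_nonneg_right hsame.1, by gcongr; exact hsame.2⟩

theorem Tally.abs_expect_exchange_sub_le {f : State → ℕ} (hf : Tally k (numLeft k) n f fl fr)
    (hn : k + 1 ≤ n) (hf₀ : ∀ A₀, f (initState k n A₀) = 0) {B : ℕ}
    (hB : ∀ g ≤ k, fl g ≤ B ∧ fr g ≤ B) :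
    |𝔼 σ, (f (MultiPivot.exchange k n (inputArray k n σ)) : ℝ) -
      (n - k - 1) * rate k (numLeft k) fl fr| ≤ B := by
  have hideal := fun σ => hf.idealCost_exchange (A₀ := inputArray k n σ) hn (hf₀ _)
    fun c => hB _ inputArray_le
  obtain ⟨hlower, hupper⟩ := expect_idealCost_mem_Icc (m := numLeft k) hn hB
  have hle : 𝔼 σ, (f (MultiPivot.exchange k n (inputArray k n σ)) : ℝ) ≤
      𝔼 σ, (idealCost k (numLeft k) n fl fr (inputArray k n σ) : ℝ) :=
    expect_le_expect fun σ _ => by exact_mod_cast (hideal σ).1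
  have hge : 𝔼 σ, (idealCost k (numLeft k) n fl fr (inputArray k n σ) : ℝ) ≤
      𝔼 σ, (f (MultiPivot.exchange k n (inputArray k n σ)) : ℝ) + B := by
    rw [← Fintype.expect_const (ι := Equiv.Perm (Fin n)) (B : ℝ), ← expect_add_distrib]
    exact expect_le_expect fun σ _ => by exact_mod_cast (hideal σ).2
  rw [abs_le]
  constructor <;> linarith

theorem expectedCost_eq_expect (X : Equiv.Perm (Fin n) → ℕ) :
    expectedCost n X = 𝔼 σ, (X σ : ℝ) := by
  rw [Fintype.expect_eq_sum_div_card, Fintype.card_perm, Fintype.card_fin, expectedCost]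

theorem expectedCost_sub_isBigO {f : ℕ → State → ℕ}
    (hf : ∀ n, Tally k (numLeft k) n (f n) fl fr)
    (hf₀ : ∀ n A₀, f n (initState k n A₀) = 0) :
    (fun n : ℕ => expectedCost n (fun σ => f n (exchange k n (inputArray k n σ))) -
      rate k (numLeft k) fl fr * (n : ℝ)) =O[Filter.atTop] (fun _ : ℕ => (1 : ℝ)) := by
  have hB : ∀ g ≤ k, fl g ≤ ∑ g ∈ range (k + 1), (fl g + fr g) ∧
      fr g ≤ ∑ g ∈ range (k + 1), (fl g + fr g) := fun g hg => by
    have hle : fl g + fr g ≤ ∑ g ∈ range (k + 1), (fl g + fr g) :=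
      single_le_sum_of_canonicallyOrdered (f := fun g => fl g + fr g)
        (mem_range.mpr (Nat.lt_succ_of_le hg))
    omega
  refine .of_bound (∑ g ∈ range (k + 1), (fl g + fr g) + |(k + 1) * rate k (numLeft k) fl fr|) ?_
  filter_upwards [Filter.eventually_ge_atTop (k + 1)] with n hn
  rw [norm_one, mul_one, Real.norm_eq_abs, expectedCost_eq_expect]
  calc |𝔼 σ, (f n (exchange k n (inputArray k n σ)) : ℝ) - rate k (numLeft k) fl fr * n|
      = |(𝔼 σ, (f n (exchange k n (inputArray k n σ)) : ℝ) -
          (n - k - 1) * rate k (numLeft k) fl fr) - (k + 1) * rate k (numLeft k) fl fr| := by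
        congr 1; ring
    _ ≤ |𝔼 σ, (f n (exchange k n (inputArray k n σ)) : ℝ) -
          (n - k - 1) * rate k (numLeft k) fl fr| + |(k + 1) * rate k (numLeft k) fl fr| :=
        abs_sub _ _
    _ ≤ _ := by gcongr; exact_mod_cast (hf n).abs_expect_exchange_sub_le hn (hf₀ n) hB

end ExpectedCost

section Rate

variable {k m r : ℕ} {fl fl' fr fr' : ℕ → ℕ}

theorem rate_congr (hl : ∀ g ≤ k, fl g = fl' g) (hr : ∀ g ≤ k, fr g = fr' g) :
    rate k m fl fr = rate k m fl' fr' := by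
  have hmem : ∀ g ∈ range (k + 1), g ≤ k := fun g hg => Nat.le_of_lt_succ (mem_range.mp hg)
  rw [rate, rate]
  congr 2
  · exact sum_congr rfl fun g hg => sum_congr rfl fun _ _ => by
      rw [hl g (hmem g hg), hr g (hmem g hg)]
  · exact sum_congr rfl fun g hg => by rw [hl g (hmem g hg), hr g (hmem g hg)]

theorem rate_add :
    rate k m (fun g => fl g + fl' g) (fun g => fr g + fr' g) =
      rate k m fl fr + rate k m fl' fr' := by
  have hite : ∀ (p : Prop) [Decidable p] (g : ℕ),
      (if p then ((fl g + fl' g : ℕ) : ℝ) else ((fr g + fr' g : ℕ) : ℝ)) =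
        (if p then (fl g : ℝ) else fr g) + if p then (fl' g : ℝ) else fr' g := fun p _ g => by
    split_ifs <;> push_cast <;> rfl
  rw [rate, rate, rate, ← add_div]
  simp only [hite, sum_add_distrib]
  ring

theorem rate_eq (h : k + 1 = m + r) :
    rate k m fl fr = ((m + 1) * ∑ g ∈ range m, (fl g : ℝ) + r * ∑ g ∈ range m, (fr g : ℝ) +
      m * ∑ u ∈ range r, (fl (m + u) : ℝ) + (r + 1) * ∑ u ∈ range r, (fr (m + u) : ℝ)) /
        ((m + r) * (m + r + 1)) := by
  have hk : (k : ℝ) + 1 = m + r := mod_cast h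
  have hsplit : ∀ φ ψ : ℕ → ℝ, ∑ g ∈ range (k + 1), (if g < m then φ g else ψ g) =
      ∑ g ∈ range m, φ g + ∑ u ∈ range r, ψ (m + u) := fun φ ψ => by
    rw [h, sum_range_add]
    congr 1
    · exact sum_congr rfl fun g hg => if_pos (mem_range.mp hg)
    · exact sum_congr rfl fun u _ => if_neg (Nat.not_lt.mpr (Nat.le_add_right m u))
  rw [rate, show (k : ℝ) + 2 = m + r + 1 by linear_combination hk, hk]
  simp only [hsplit, sum_const, card_range, nsmul_eq_mul, sum_add_distrib, ← mul_sum]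
  rw [h, sum_range_add, sum_range_add]
  ring

theorem sum_range_add_one (N : ℕ) : ∑ u ∈ range N, ((u + 1 : ℕ) : ℝ) = N * (N + 1) / 2 := by
  induction N with
  | zero => norm_num
  | succ N ih =>
    rw [sum_range_succ, ih]
    push_cast
    ring

theorem sum_visits_left (m : ℕ) : ∑ g ∈ range m, (visits m g : ℝ) = m * (m + 1) / 2 := by
  rw [← sum_range_add_one, ← sum_range_reflect]
  refine sum_congr rfl fun u hu => ?_
  have := mem_range.mp hu
  rw [visits, if_pos (by omega)]
  congr 1
  omega

theorem sum_visits_right (m r : ℕ) :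
    ∑ u ∈ range r, (visits m (m + u) : ℝ) = r * (r + 1) / 2 := by
  rw [← sum_range_add_one]
  refine sum_congr rfl fun u _ => ?_
  rw [visits, if_neg (by omega), Nat.add_sub_cancel_left]

theorem rate_visits (h : k + 1 = m + r) :
    rate k m (visits m) (visits m) = (m * (m + 1) + r * (r + 1)) / (2 * (m + r)) := by
  have hpos : (0 : ℝ) < m + r := mod_cast h ▸ k.succ_pos
  rw [rate_eq h, sum_visits_left, sum_visits_right]
  field_simp
  ring

theorem rate_unmoved (h : k + 1 = m + r) (hm : 1 ≤ m) (hr : 1 ≤ r) :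
    rate k m (fun g => if g + 1 = m then 1 else 0) (fun g => if g = m then 1 else 0) =
      (m + r + 2) / ((m + r) * (m + r + 1)) := by
  have hll : ∑ g ∈ range m, ((if g + 1 = m then 1 else 0 : ℕ) : ℝ) = 1 := by
    obtain ⟨m, rfl⟩ := Nat.exists_eq_add_of_le' hm
    simp
  have hlr : ∑ g ∈ range m, ((if g = m then 1 else 0 : ℕ) : ℝ) = 0 := by
    simp
  have hrl : ∑ u ∈ range r, ((if m + u + 1 = m then 1 else 0 : ℕ) : ℝ) = 0 := by
    simp [add_assoc]
  have hrr : ∑ u ∈ range r, ((if m + u = m then 1 else 0 : ℕ) : ℝ) = 1 := by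
    simp [Nat.pos_iff_ne_zero.mp hr]
  rw [rate_eq h, hll, hlr, hrl, hrr]
  ring

theorem rate_rotations (h : k + 1 = m + r) (hm : 1 ≤ m) (hr : 1 ≤ r) :
    rate k m (fun g => if g + 1 < m then 1 else 0) (fun g => if g = m then 0 else 1) =
      ((m + 1) * (m - 1) + r * m + (r + 1) * (r - 1)) / ((m + r) * (m + r + 1)) := by
  have hll : ∑ g ∈ range m, ((if g + 1 < m then 1 else 0 : ℕ) : ℝ) = m - 1 := by
    obtain ⟨m, rfl⟩ := Nat.exists_eq_add_of_le' hm
    rw [sum_range_succ, if_neg (lt_irrefl _),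
      sum_congr rfl fun g hg => by rw [if_pos (Nat.succ_lt_succ (mem_range.mp hg))]]
    simp
  have hlr : ∑ g ∈ range m, ((if g = m then 0 else 1 : ℕ) : ℝ) = m := by
    rw [sum_congr rfl fun g hg => by rw [if_neg (mem_range.mp hg).ne]]
    simp
  have hrl : ∑ u ∈ range r, ((if m + u + 1 < m then 1 else 0 : ℕ) : ℝ) = 0 := by
    simp [add_assoc]
  have hrr : ∑ u ∈ range r, ((if m + u = m then 0 else 1 : ℕ) : ℝ) = r - 1 := by
    obtain ⟨r, rfl⟩ := Nat.exists_eq_add_of_le' hr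
    simp [sum_range_succ']
  rw [rate_eq h, hll, hlr, hrl, hrr]
  ring

theorem rate_writes (h : k + 1 = m + r) (hm : 1 ≤ m) (hr : 1 ≤ r) :
    rate k m (writesLeft m) (writesRight m) =
      (m * (m + 1) + r * (r + 1)) / (2 * (m + r)) - (m + r + 2) / ((m + r) * (m + r + 1)) := by
  rw [← rate_visits h, ← rate_unmoved h hm hr, eq_sub_iff_add_eq, ← rate_add]
  refine rate_congr (fun g _ => ?_) fun g _ => ?_
  · rw [writesLeft, visits]
    split_ifs <;> omega
  · rw [writesRight, visits]
    split_ifs <;> omega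

theorem rate_assigns (h : k + 1 = m + r) (hm : 1 ≤ m) (hr : 1 ≤ r) :
    rate k m (assignsLeft m) (assignsRight m) =
      (m * (m + 1) + r * (r + 1)) / (2 * (m + r)) - (m + r + 2) / ((m + r) * (m + r + 1)) +
        ((m + 1) * (m - 1) + r * m + (r + 1) * (r - 1)) / ((m + r) * (m + r + 1)) := by
  rw [← rate_writes h hm hr, ← rate_rotations h hm hr, ← rate_add]
  rfl

end Rate

section ClosedForms

variable {k m : ℕ}

theorem rate_visits_of_odd (h : k + 1 = m + m) :
    rate k m (visits m) (visits m) = ((m : ℝ) + 1) / 2 := by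
  have hm : (0 : ℝ) < m := by norm_cast; omega
  rw [rate_visits h]
  field_simp

theorem rate_writes_of_odd (h : k + 1 = m + m) :
    rate k m (writesLeft m) (writesRight m) =
      (2 * (m : ℝ) ^ 3 + 3 * (m : ℝ) ^ 2 - m - 2) / (2 * m * (2 * m + 1)) := by
  have hm : 1 ≤ m := by omega
  have hm₀ : (0 : ℝ) < m := mod_cast hm
  rw [rate_writes h hm hm, ← two_mul (m : ℝ)]
  field_simp [hm₀.ne']
  ring

theorem rate_assigns_of_odd (h : k + 1 = m + m) :
    rate k m (assignsLeft m) (assignsRight m) =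
      (2 * (m : ℝ) ^ 3 + 6 * (m : ℝ) ^ 2 - m - 4) / (2 * m * (2 * m + 1)) := by
  have hm : 1 ≤ m := by omega
  have hm₀ : (0 : ℝ) < m := mod_cast hm
  rw [rate_assigns h hm hm, ← two_mul (m : ℝ)]
  field_simp [hm₀.ne']
  ring

theorem rate_visits_of_even (h : k + 2 = m + m) :
    rate k m (visits m) (visits m) = (m : ℝ) ^ 2 / (2 * m - 1) := by
  obtain ⟨r, rfl⟩ := Nat.exists_eq_add_of_le' (show 1 ≤ m by omega)
  rw [rate_visits (r := r) (by omega)]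
  push_cast
  rw [show 2 * ((r : ℝ) + 1) - 1 = 2 * r + 1 by ring, show (r : ℝ) + 1 + r = 2 * r + 1 by ring]
  field_simp
  ring

theorem rate_writes_of_even (hk : 1 ≤ k) (h : k + 2 = m + m) :
    rate k m (writesLeft m) (writesRight m) =
      (2 * (m : ℝ) ^ 3 - 2 * m - 1) / (2 * m * (2 * m - 1)) := by
  obtain ⟨r, rfl⟩ := Nat.exists_eq_add_of_le' (show 1 ≤ m by omega)
  rw [rate_writes (r := r) (by omega) (by omega) (by omega)]
  push_cast
  rw [show 2 * ((r : ℝ) + 1) - 1 = 2 * r + 1 by ring, show (r : ℝ) + 1 + r = 2 * r + 1 by ring]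
  field_simp
  ring

theorem rate_assigns_of_even (hk : 1 ≤ k) (h : k + 2 = m + m) :
    rate k m (assignsLeft m) (assignsRight m) =
      (2 * (m : ℝ) ^ 3 + 3 * (m : ℝ) ^ 2 - 5 * m - 2) / (2 * m * (2 * m - 1)) := by
  obtain ⟨r, rfl⟩ := Nat.exists_eq_add_of_le' (show 1 ≤ m by omega)
  rw [rate_assigns (r := r) (by omega) (by omega) (by omega)]
  push_cast
  rw [show 2 * ((r : ℝ) + 1) - 1 = 2 * r + 1 by ring, show (r : ℝ) + 1 + r = 2 * r + 1 by ring]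
  field_simp
  ring

end ClosedForms

theorem numLeft_eq (k : ℕ) : numLeft k = (k + 2) / 2 := by
  rw [numLeft, Nat.ceilDiv_eq_add_pred_div]
  rfl

theorem add_one_eq_numLeft_add_numLeft {k : ℕ} (hk : Odd k) :
    k + 1 = numLeft k + numLeft k := by
  obtain ⟨a, rfl⟩ := hk
  rw [numLeft_eq]
  omega

theorem add_two_eq_numLeft_add_numLeft {k : ℕ} (hk : Even k) :
    k + 2 = numLeft k + numLeft k := by
  obtain ⟨a, rfl⟩ := hk
  rw [numLeft_eq]
  omega

section Asymptotics

variable {k : ℕ}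

theorem expectedCost_scanned_isBigO (hk : 1 ≤ k) :
    (fun n : ℕ => expectedCost n (scanned k n) -
      rate k (numLeft k) (visits (numLeft k)) (visits (numLeft k)) * (n : ℝ)) =O[Filter.atTop]
        (fun _ : ℕ => (1 : ℝ)) := by
  have hscans : ∀ g ≤ k, scans k (numLeft k) g = visits (numLeft k) g := fun g hg =>
    scans_eq_visits (by rw [numLeft_eq]; omega) (by rw [numLeft_eq]; omega) hg
  rw [← rate_congr hscans hscans]
  refine expectedCost_sub_isBigO (f := fun n s => pointerCost (k + 1) s.i + pointerCost n s.j +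
    ∑ t ∈ Icc 1 (k - 1), pointerCost (if t < numLeft k then k + 1 else n) (s.b t))
    (fun _ => Tally.scanned) fun n A₀ => ?_
  simp only [initState, pointerCost, sub_self, Int.natAbs_zero, sum_const_zero, add_zero]

theorem expectedCost_writeAccesses_isBigO :
    (fun n : ℕ => expectedCost n (writeAccesses k n) -
      rate k (numLeft k) (writesLeft (numLeft k)) (writesRight (numLeft k)) * (n : ℝ))
        =O[Filter.atTop] (fun _ : ℕ => (1 : ℝ)) :=
  expectedCost_sub_isBigO (fun _ => Tally.writes) fun _ _ => rfl

theorem expectedCost_assignments_isBigO :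
    (fun n : ℕ => expectedCost n (assignments k n) -
      rate k (numLeft k) (assignsLeft (numLeft k)) (assignsRight (numLeft k)) * (n : ℝ))
        =O[Filter.atTop] (fun _ : ℕ => (1 : ℝ)) :=
  expectedCost_sub_isBigO (fun _ => Tally.assigns) fun _ _ => rfl

end Asymptotics

end MultiPivot

theorem mainTheorem7 (k : ℕ) (hk : 1 ≤ k) (m : ℕ) (hm : m = (k + 1) ⌈/⌉ 2) :
    (Odd k →
      (fun n : ℕ => MultiPivot.expectedCost n (MultiPivot.scanned k n)
          - ((m : ℝ) + 1) / 2 * (n : ℝ)) =O[Filter.atTop] (fun _ : ℕ => (1 : ℝ)) ∧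
      (fun n : ℕ => MultiPivot.expectedCost n (MultiPivot.writeAccesses k n)
          - (2 * (m : ℝ) ^ 3 + 3 * (m : ℝ) ^ 2 - (m : ℝ) - 2) / (2 * (m : ℝ) * (2 * (m : ℝ) + 1))
            * (n : ℝ)) =O[Filter.atTop] (fun _ : ℕ => (1 : ℝ)) ∧
      (fun n : ℕ => MultiPivot.expectedCost n (MultiPivot.assignments k n)
          - (2 * (m : ℝ) ^ 3 + 6 * (m : ℝ) ^ 2 - (m : ℝ) - 4) / (2 * (m : ℝ) * (2 * (m : ℝ) + 1))
            * (n : ℝ)) =O[Filter.atTop] (fun _ : ℕ => (1 : ℝ))) ∧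
    (Even k →
      (fun n : ℕ => MultiPivot.expectedCost n (MultiPivot.scanned k n)
          - (m : ℝ) ^ 2 / (2 * (m : ℝ) - 1) * (n : ℝ)) =O[Filter.atTop] (fun _ : ℕ => (1 : ℝ)) ∧
      (fun n : ℕ => MultiPivot.expectedCost n (MultiPivot.writeAccesses k n)
          - (2 * (m : ℝ) ^ 3 - 2 * (m : ℝ) - 1) / (2 * (m : ℝ) * (2 * (m : ℝ) - 1))
            * (n : ℝ)) =O[Filter.atTop] (fun _ : ℕ => (1 : ℝ)) ∧
      (fun n : ℕ => MultiPivot.expectedCost n (MultiPivot.assignments k n)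
          - (2 * (m : ℝ) ^ 3 + 3 * (m : ℝ) ^ 2 - 5 * (m : ℝ) - 2) / (2 * (m : ℝ) * (2 * (m : ℝ) - 1))
            * (n : ℝ)) =O[Filter.atTop] (fun _ : ℕ => (1 : ℝ))) := by
  obtain rfl : m = MultiPivot.numLeft k := hm
  have hscanned := MultiPivot.expectedCost_scanned_isBigO hk
  have hwrites := MultiPivot.expectedCost_writeAccesses_isBigO (k := k)
  have hassigns := MultiPivot.expectedCost_assignments_isBigO (k := k)
  constructor
  · intro hodd
    have h := MultiPivot.add_one_eq_numLeft_add_numLeft hodd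
    rw [← MultiPivot.rate_visits_of_odd h, ← MultiPivot.rate_writes_of_odd h,
      ← MultiPivot.rate_assigns_of_odd h]
    exact ⟨hscanned, hwrites, hassigns⟩
  · intro heven
    have h := MultiPivot.add_two_eq_numLeft_add_numLeft heven
    rw [← MultiPivot.rate_visits_of_even h, ← MultiPivot.rate_writes_of_even hk h,
      ← MultiPivot.rate_assigns_of_even hk h]
    exact ⟨hscanned, hwrites, hassigns⟩
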